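/- Let $\alpha\in\mathbb{R}$, let $\theta\in\mathbb{R}$ with $\theta/2\pi$ irrational, and let $f:\mathbb{T}\to\mathbb{T}$ be a continuous function on the unit circle. Let $\mathbb{A}_\alpha$ be the noncommutative torus, i.e. the universal unital $C^*$-algebra generated by two unitaries $U,V$ with $UV=e^{2\pi i\alpha}VU$; let $\tau$ be its canonical tracial state, determined by $\tau(U^mV^n)=\delta_{m,0}\delta_{n,0}$ for $m,n\in\mathbb{Z}$; and let $\Phi_{\theta,f}$ be the Anzai skew-product, i.e. the unique $*$-automorphism of $\mathbb{A}_\alpha$ with $\Phi_{\theta,f}(U)=e^{i\theta}U$ and $\Phi_{\theta,f}(V)=f(U)V$, where $f(U)$ is given by the continuous functional calculus. A state $\omega$ of $\mathbb{A}_\alpha$ is called invariant if $\omega\circ\Phi_{\theta,f}=\omega$. Suppose that $(\mathbb{A}_\alpha,\Phi_{\theta,f},\tau)$ is ergodic, i.e. that $\tau$ is an extreme point of the convex set of invariant states. Then $(\mathbb{A}_\alpha,\Phi_{\theta,f})$ is uniquely ergodic, i.e. it has exactly one invariant state, and this unique invariant state is $\tau$. -/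

import Mathlib

noncomputable section

namespace NCTorus

/-- The conjugate-linear antiautomorphism of the group algebra `ℂ[G]` with `g ↦ g⁻¹`. -/
def groupAlgebraStar (G : Type) [Group G] :
    MonoidAlgebra ℂ G →+* (MonoidAlgebra ℂ G)ᵐᵒᵖ :=
  MonoidAlgebra.liftNCRingHom
    ((algebraMap ℂ (MonoidAlgebra ℂ G)ᵐᵒᵖ).comp (starRingEnd ℂ))
    ({ toFun := fun g => MulOpposite.op (MonoidAlgebra.of ℂ G g⁻¹)
       map_one' := by rw [inv_one, map_one, MulOpposite.op_one]
       map_mul' := fun g h => by rw [mul_inv_rev, map_mul, MulOpposite.op_mul] } :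
      G →* (MonoidAlgebra ℂ G)ᵐᵒᵖ)
    (fun c _ => Algebra.commutes (starRingEnd ℂ c) _)

theorem groupAlgebraStar_of {G : Type} [Group G] (g : G) :
    groupAlgebraStar G (MonoidAlgebra.of ℂ G g) = MulOpposite.op (MonoidAlgebra.of ℂ G g⁻¹) :=
  (MonoidAlgebra.liftNC_single _ _ _ _).trans (by
    rw [AddMonoidHom.coe_coe, map_one, one_mul]; rfl)

theorem groupAlgebraStar_algebraMap {G : Type} [Group G] (c : ℂ) :
    groupAlgebraStar G (algebraMap ℂ _ c) = algebraMap ℂ (MonoidAlgebra ℂ G)ᵐᵒᵖ (star c) :=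
  (MonoidAlgebra.liftNC_single _ _ _ _).trans (by simp [← MonoidAlgebra.one_def])

/-- The group algebra `ℂ[F₂]` of the free group on two letters, i.e. the *-algebra of
noncommutative Laurent polynomials in two unitary indeterminates. The parameter `α` is carried
along because the seminorm below depends on it. -/
def Pre (_α : ℝ) : Type := MonoidAlgebra ℂ (FreeGroup (Fin 2))

variable (α : ℝ)

instance : Ring (Pre α) := inferInstanceAs (Ring (MonoidAlgebra ℂ (FreeGroup (Fin 2))))
instance : Algebra ℂ (Pre α) :=
  inferInstanceAs (Algebra ℂ (MonoidAlgebra ℂ (FreeGroup (Fin 2))))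

/-- A word in the two unitary indeterminates, as an element of the group algebra. -/
def Pre.word : FreeGroup (Fin 2) →* Pre α := MonoidAlgebra.of ℂ (FreeGroup (Fin 2))

theorem Pre.induction {P : Pre α → Prop} (x : Pre α)
    (hw : ∀ g, P (Pre.word α g)) (ha : ∀ x y, P x → P y → P (x + y))
    (hs : ∀ (c : ℂ) x, P x → P (c • x)) : P x :=
  MonoidAlgebra.induction_on x hw ha hs

/-- The involution of `ℂ[F₂]`, as a ring homomorphism to the opposite ring. -/
def Pre.starHom : Pre α →+* (Pre α)ᵐᵒᵖ := groupAlgebraStar (FreeGroup (Fin 2))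

instance : Star (Pre α) := ⟨fun x => (Pre.starHom α x).unop⟩

theorem Pre.star_def (x : Pre α) : star x = (Pre.starHom α x).unop := rfl

theorem Pre.star_word (g : FreeGroup (Fin 2)) :
    star (Pre.word α g) = Pre.word α g⁻¹ := by
  rw [Pre.star_def]
  exact congrArg MulOpposite.unop (groupAlgebraStar_of g)

theorem Pre.star_algebraMap (c : ℂ) :
    star (algebraMap ℂ (Pre α) c) = algebraMap ℂ (Pre α) (star c) := by
  rw [Pre.star_def]
  exact congrArg MulOpposite.unop (groupAlgebraStar_algebraMap c)

theorem Pre.star_add' (x y : Pre α) : star (x + y) = star x + star y := by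
  simp [Pre.star_def]

theorem Pre.star_mul' (x y : Pre α) : star (x * y) = star y * star x := by
  simp [Pre.star_def]

theorem Pre.star_smul' (c : ℂ) (x : Pre α) : star (c • x) = star c • star x := by
  rw [Algebra.smul_def, Pre.star_mul', Pre.star_algebraMap, Algebra.smul_def,
    Algebra.commutes]

instance : StarRing (Pre α) where
  star_involutive x := by
    induction x using Pre.induction α with
    | hw g => simp [Pre.star_word]
    | ha x y hx hy => rw [Pre.star_add', Pre.star_add', hx, hy]
    | hs c x hx => rw [Pre.star_smul', Pre.star_smul', hx, star_star]
  star_mul := Pre.star_mul' α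
  star_add := Pre.star_add' α

instance : StarModule ℂ (Pre α) := ⟨Pre.star_smul' α⟩

/-- The C*-seminorms on `ℂ[F₂]` for which the relation `U V = e^{2πiα} V U` holds. -/
structure IsTorusSeminorm (p : Seminorm ℂ (Pre α)) : Prop where
  mul_le : ∀ x y, p (x * y) ≤ p x * p y
  star_mul_self : ∀ x, p (star x * x) = p x ^ 2
  rel : p (Pre.word α (FreeGroup.of 0) * Pre.word α (FreeGroup.of 1) -
    Complex.exp (2 * Real.pi * Complex.I * α) •
      (Pre.word α (FreeGroup.of 1) * Pre.word α (FreeGroup.of 0))) = 0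

variable {α}

theorem IsTorusSeminorm.word_le {p : Seminorm ℂ (Pre α)} (hp : IsTorusSeminorm α p)
    (g : FreeGroup (Fin 2)) : p (Pre.word α g) ≤ 1 := by
  have h1 : p 1 ≤ 1 := by
    have h := hp.star_mul_self 1
    rw [star_one, one_mul] at h
    nlinarith [apply_nonneg p 1]
  have h2 := hp.star_mul_self (Pre.word α g)
  rw [Pre.star_word, ← map_mul, inv_mul_cancel, map_one] at h2
  nlinarith [apply_nonneg p (Pre.word α g)]

theorem exists_bound (x : Pre α) :
    ∃ C, ∀ p : Seminorm ℂ (Pre α), IsTorusSeminorm α p → p x ≤ C := by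
  induction x using Pre.induction α with
  | hw g => exact ⟨1, fun p hp => hp.word_le g⟩
  | ha x y hx hy =>
    obtain ⟨C, hC⟩ := hx
    obtain ⟨D, hD⟩ := hy
    exact ⟨C + D, fun p hp => (map_add_le_add p x y).trans (add_le_add (hC p hp) (hD p hp))⟩
  | hs c x hx =>
    obtain ⟨C, hC⟩ := hx
    exact ⟨‖c‖ * C, fun p hp => by
      rw [map_smul_eq_mul]; exact mul_le_mul_of_nonneg_left (hC p hp) (norm_nonneg c)⟩

theorem bddAbove (x : Pre α) :
    BddAbove (Set.range fun p : {p : Seminorm ℂ (Pre α) // IsTorusSeminorm α p} => p.1 x) := by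
  obtain ⟨C, hC⟩ := exists_bound x
  exact ⟨C, by rintro _ ⟨p, rfl⟩; exact hC p.1 p.2⟩

instance : Nonempty {p : Seminorm ℂ (Pre α) // IsTorusSeminorm α p} :=
  ⟨0, by constructor <;> simp⟩

theorem IsTorusSeminorm.star_le {p : Seminorm ℂ (Pre α)} (hp : IsTorusSeminorm α p)
    (x : Pre α) : p (star x) ≤ p x := by
  have h := hp.star_mul_self (star x)
  have h2 := hp.mul_le (star (star x)) (star x)
  rw [h, star_star] at h2
  have := apply_nonneg p x
  have := apply_nonneg p (star x)
  by_contra hc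
  push Not at hc
  nlinarith

variable (α)

/-- The largest C*-seminorm. -/
def univNorm (x : Pre α) : ℝ :=
  ⨆ p : {p : Seminorm ℂ (Pre α) // IsTorusSeminorm α p}, p.1 x

variable {α}

theorem le_univNorm {p : Seminorm ℂ (Pre α)} (hp : IsTorusSeminorm α p) (x : Pre α) :
    p x ≤ univNorm α x := le_ciSup (bddAbove x) ⟨p, hp⟩

theorem univNorm_le {x : Pre α} {C : ℝ}
    (h : ∀ p : Seminorm ℂ (Pre α), IsTorusSeminorm α p → p x ≤ C) : univNorm α x ≤ C :=
  ciSup_le fun p => h p.1 p.2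

theorem univNorm_nonneg (x : Pre α) : 0 ≤ univNorm α x :=
  Real.iSup_nonneg fun p => apply_nonneg p.1 x

theorem univNorm_add_le (x y : Pre α) : univNorm α (x + y) ≤ univNorm α x + univNorm α y :=
  univNorm_le fun p hp =>
    (map_add_le_add p x y).trans (add_le_add (le_univNorm hp x) (le_univNorm hp y))

theorem univNorm_smul_le (c : ℂ) (x : Pre α) : univNorm α (c • x) ≤ ‖c‖ * univNorm α x :=
  univNorm_le fun p hp => by
    rw [map_smul_eq_mul]; exact mul_le_mul_of_nonneg_left (le_univNorm hp x) (norm_nonneg c)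

theorem univNorm_mul_le (x y : Pre α) : univNorm α (x * y) ≤ univNorm α x * univNorm α y :=
  univNorm_le fun p hp => (hp.mul_le x y).trans
    (mul_le_mul (le_univNorm hp x) (le_univNorm hp y) (apply_nonneg p y) (univNorm_nonneg x))

theorem univNorm_star_le (x : Pre α) : univNorm α (star x) ≤ univNorm α x :=
  univNorm_le fun _ hp => (hp.star_le x).trans (le_univNorm hp x)

theorem univNorm_sq_le (x : Pre α) : univNorm α x * univNorm α x ≤ univNorm α (star x * x) := by
  have h0 := univNorm_nonneg (star x * x)
  have : univNorm α x ≤ √(univNorm α (star x * x)) := univNorm_le fun p hp => by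
    apply Real.le_sqrt_of_sq_le
    rw [← hp.star_mul_self]; exact le_univNorm hp _
  calc _ ≤ √(univNorm α (star x * x)) * √(univNorm α (star x * x)) :=
        mul_self_le_mul_self (univNorm_nonneg x) this
    _ = _ := Real.mul_self_sqrt h0

variable (α)

/-- The largest C*-seminorm, as a seminorm. -/
def univSeminorm : Seminorm ℂ (Pre α) :=
  Seminorm.ofSMulLE (univNorm α)
    (le_antisymm (univNorm_le fun _ _ => by simp) (univNorm_nonneg 0))
    univNorm_add_le univNorm_smul_le

instance : SeminormedRing (Pre α) where
  __ := (univSeminorm α).toAddGroupSeminorm.toSeminormedAddCommGroup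
  __ := (inferInstance : Ring (Pre α))
  norm_mul_le := univNorm_mul_le

theorem Pre.norm_def (x : Pre α) : ‖x‖ = univNorm α x := rfl

instance : NormedAlgebra ℂ (Pre α) where
  norm_smul_le := univNorm_smul_le

instance : NormedStarGroup (Pre α) := ⟨univNorm_star_le⟩

end NCTorus

open UniformSpace in
/-- The noncommutative torus `𝔸_α`: the universal unital C*-algebra generated by unitaries `U`, `V`
with `U V = e^{2πiα} V U`, constructed as the Hausdorff completion of `ℂ[F₂]` in the largest
C*-seminorm compatible with the relation. Its universal property is `NCTorus.lift` together with
`NCTorus.lift_U`, `NCTorus.lift_V` and `NCTorus.hom_ext`. -/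
def NCTorus (α : ℝ) : Type := Completion (NCTorus.Pre α)

namespace NCTorus
open UniformSpace

variable (α : ℝ)

instance : NormedRing (NCTorus α) := inferInstanceAs (NormedRing (Completion (Pre α)))
instance : CompleteSpace (NCTorus α) := inferInstanceAs (CompleteSpace (Completion (Pre α)))
instance : Algebra ℂ (NCTorus α) := inferInstanceAs (Algebra ℂ (Completion (Pre α)))
instance : NormedSpace ℂ (NCTorus α) := inferInstanceAs (NormedSpace ℂ (Completion (Pre α)))
instance : NormedAlgebra ℂ (NCTorus α) where
  norm_smul_le := norm_smul_le (α := ℂ) (β := Completion (Pre α))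

/-- The canonical map `ℂ[F₂] → 𝔸_α`. -/
def ofPre : Pre α →ₐ[ℂ] NCTorus α where
  __ := (Completion.coeRingHom : Pre α →+* Completion (Pre α))
  commutes' _ := rfl

theorem isometry_ofPre : Isometry (ofPre α) := Completion.coe_isometry

theorem denseRange_ofPre : DenseRange (ofPre α) := Completion.denseRange_coe

instance : Star (NCTorus α) := ⟨Completion.map (star : Pre α → Pre α)⟩

theorem star_ofPre (x : Pre α) : star (ofPre α x) = ofPre α (star x) :=
  Completion.map_coe star_isometry.uniformContinuous x

theorem continuous_star' : Continuous (star : NCTorus α → NCTorus α) :=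
  Completion.continuous_map

theorem induction {P : NCTorus α → Prop} (x : NCTorus α) (hc : IsClosed {x | P x})
    (h : ∀ x, P (ofPre α x)) : P x :=
  (denseRange_ofPre α).induction_on x hc h

instance : CStarAlgebra (NCTorus α) where
  star_involutive x := by
    refine induction α (P := fun x => star (star x) = x) x
      (isClosed_eq ((continuous_star' α).comp (continuous_star' α)) continuous_id) fun x => ?_
    rw [star_ofPre, star_ofPre, star_star]
  star_mul x y := by
    refine (denseRange_ofPre α).induction_on₂ (p := fun x y => star (x * y) = star y * star x)
      (isClosed_eq ((continuous_star' α).comp continuous_mul)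
        (((continuous_star' α).comp continuous_snd).mul
          ((continuous_star' α).comp continuous_fst))) (fun x y => ?_) x y
    rw [← map_mul, star_ofPre, star_ofPre, star_ofPre, star_mul, map_mul]
  star_add x y := by
    refine (denseRange_ofPre α).induction_on₂ (p := fun x y => star (x + y) = star x + star y)
      (isClosed_eq ((continuous_star' α).comp continuous_add)
        (((continuous_star' α).comp continuous_fst).add
          ((continuous_star' α).comp continuous_snd))) (fun x y => ?_) x y
    rw [← map_add, star_ofPre, star_ofPre, star_ofPre, star_add, map_add]
  star_smul c x := by
    refine induction α (P := fun x => star (c • x) = star c • star x) x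
      (isClosed_eq ((continuous_star' α).comp (continuous_const_smul c))
        ((continuous_const_smul (star c)).comp (continuous_star' α))) fun x => ?_
    rw [← map_smul, star_ofPre, star_ofPre, star_smul, map_smul]
  norm_mul_self_le x := by
    refine induction α (P := fun x => ‖x‖ * ‖x‖ ≤ ‖star x * x‖) x
      (isClosed_le (continuous_norm.mul continuous_norm)
        (continuous_norm.comp ((continuous_star' α).mul continuous_id))) fun x => ?_
    rw [star_ofPre, ← map_mul, ← dist_zero_right, ← dist_zero_right (ofPre α (_ * _)),
      ← map_zero (ofPre α), (isometry_ofPre α).dist_eq, (isometry_ofPre α).dist_eq,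
      dist_zero_right, dist_zero_right]
    exact univNorm_sq_le x

/-- The image in `𝔸_α` of a word in the two unitary indeterminates. -/
def word : FreeGroup (Fin 2) →* unitary (NCTorus α) where
  toFun g := ⟨ofPre α (Pre.word α g), by
    rw [Unitary.mem_iff, star_ofPre, Pre.star_word, ← map_mul, ← map_mul, ← map_mul, ← map_mul]
    simp⟩
  map_one' := by ext; simp
  map_mul' g h := by ext; simp

/-- The first generator of `𝔸_α`. -/
def U : unitary (NCTorus α) := word α (FreeGroup.of 0)

/-- The second generator of `𝔸_α`. -/
def V : unitary (NCTorus α) := word α (FreeGroup.of 1)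

end NCTorus

/-- The commutation relation `u v = e^{2πiα} v u`. -/
def TorusRelation (α : ℝ) {B : Type*} [CStarAlgebra B] (u v : unitary B) : Prop :=
  (u : B) * v = Complex.exp (2 * Real.pi * Complex.I * α) • ((v : B) * u)

namespace NCTorus
open UniformSpace

variable (α : ℝ)

theorem torusRelation_U_V : TorusRelation α (U α) (V α) := by
  have : ‖Pre.word α (FreeGroup.of 0) * Pre.word α (FreeGroup.of 1) -
    Complex.exp (2 * Real.pi * Complex.I * α) •
      (Pre.word α (FreeGroup.of 1) * Pre.word α (FreeGroup.of 0))‖ = 0 :=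
    le_antisymm (univNorm_le fun _ hp => hp.rel.le) (norm_nonneg _)
  rw [← dist_zero_right, ← (isometry_ofPre α).dist_eq, map_zero, dist_zero_right, norm_eq_zero,
    map_sub, map_smul, map_mul, map_mul, sub_eq_zero] at this
  exact this

variable {α} {B : Type*} [CStarAlgebra B]

/-- The *-homomorphism `ℂ[F₂] → B` sending the two letters to `u` and `v`. -/
def preLift (α : ℝ) (u v : unitary B) : Pre α →ₐ[ℂ] B :=
  MonoidAlgebra.lift ℂ B (FreeGroup (Fin 2))
    ((unitary B).subtype.comp (FreeGroup.lift ![u, v]))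

theorem preLift_word (u v : unitary B) (g : FreeGroup (Fin 2)) :
    preLift α u v (Pre.word α g) = (FreeGroup.lift ![u, v] g : unitary B) :=
  MonoidAlgebra.lift_of _ g

theorem preLift_star (u v : unitary B) (x : Pre α) :
    preLift α u v (star x) = star (preLift α u v x) := by
  induction x using Pre.induction α with
  | hw g => rw [Pre.star_word, preLift_word, preLift_word, map_inv]; rfl
  | ha x y hx hy => rw [star_add, map_add, map_add, star_add, hx, hy]
  | hs c x hx => rw [star_smul, map_smul, map_smul, star_smul, hx]

theorem norm_preLift_le {u v : unitary B} (h : TorusRelation α u v) (x : Pre α) :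
    ‖preLift α u v x‖ ≤ ‖x‖ := by
  refine le_univNorm (p := (normSeminorm ℂ B).comp (preLift α u v).toLinearMap) ⟨?_, ?_, ?_⟩ x
  · intro x y
    simpa using norm_mul_le (preLift α u v x) (preLift α u v y)
  · intro x
    simp [preLift_star, CStarRing.norm_star_mul_self, sq]
  · have : (u : B) * v - Complex.exp (2 * Real.pi * Complex.I * α) • ((v : B) * u) = 0 :=
      sub_eq_zero.2 h
    simpa [preLift_word] using this

theorem continuous_preLift {u v : unitary B} (h : TorusRelation α u v) :
    Continuous (preLift α u v : Pre α →+* B) :=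
  AddMonoidHomClass.continuous_of_bound (preLift α u v) 1 fun x => by
    rw [one_mul]; exact norm_preLift_le h x

/-- The extension of `preLift` to the completion. -/
def liftRingHom (u v : unitary B) (h : TorusRelation α u v) : NCTorus α →+* B :=
  Completion.extensionHom (preLift α u v : Pre α →+* B) (continuous_preLift h)

theorem liftRingHom_ofPre (u v : unitary B) (h : TorusRelation α u v) (x : Pre α) :
    liftRingHom u v h (ofPre α x) = preLift α u v x :=
  Completion.extensionHom_coe (preLift α u v : Pre α →+* B) (continuous_preLift h) x

theorem continuous_liftRingHom (u v : unitary B) (h : TorusRelation α u v) :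
    Continuous (liftRingHom u v h) :=
  Completion.continuous_extension (f := (preLift α u v : Pre α → B))

/-- The universal property of `𝔸_α`: the *-homomorphism with `U ↦ u`, `V ↦ v`. -/
def lift (u v : unitary B) (h : TorusRelation α u v) : NCTorus α →⋆ₐ[ℂ] B where
  __ := liftRingHom u v h
  commutes' c := (liftRingHom_ofPre u v h _).trans ((preLift α u v).commutes c)
  map_star' x := by
    refine induction α (P := fun x => liftRingHom u v h (star x) = star (liftRingHom u v h x)) x
      (isClosed_eq ((continuous_liftRingHom u v h).comp (continuous_star' α))
        (continuous_star.comp (continuous_liftRingHom u v h))) fun x => ?_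
    rw [star_ofPre, liftRingHom_ofPre, liftRingHom_ofPre, preLift_star]

theorem lift_ofPre (u v : unitary B) (h : TorusRelation α u v) (x : Pre α) :
    lift u v h (ofPre α x) = preLift α u v x :=
  liftRingHom_ofPre u v h x

@[simp]
theorem lift_U (u v : unitary B) (h : TorusRelation α u v) : lift u v h (U α) = u :=
  (lift_ofPre u v h _).trans ((preLift_word u v _).trans (by simp))

@[simp]
theorem lift_V (u v : unitary B) (h : TorusRelation α u v) : lift u v h (V α) = v :=
  (lift_ofPre u v h _).trans ((preLift_word u v _).trans (by simp))

theorem continuous_starAlgHom {A : Type*} [CStarAlgebra A] (φ : A →⋆ₐ[ℂ] B) : Continuous φ :=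
  AddMonoidHomClass.continuous_of_bound φ 1 fun x => by
    rw [one_mul]; exact NonUnitalStarAlgHom.norm_apply_le φ x

theorem hom_ext {φ ψ : NCTorus α →⋆ₐ[ℂ] B} (hU : φ (U α) = ψ (U α)) (hV : φ (V α) = ψ (V α)) :
    φ = ψ := by
  have key : ((φ : NCTorus α →* B).comp ((unitary (NCTorus α)).subtype.comp (word α))) =
      ((ψ : NCTorus α →* B).comp ((unitary (NCTorus α)).subtype.comp (word α))) := by
    ext i
    fin_cases i
    · exact hU
    · exact hV
  refine StarAlgHom.ext fun x => ?_
  refine induction α (P := fun x => φ x = ψ x) x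
    (isClosed_eq (continuous_starAlgHom φ) (continuous_starAlgHom ψ)) fun x => ?_
  induction x using Pre.induction α with
  | hw g => exact DFunLike.congr_fun key g
  | ha x y hx hy => rw [map_add, map_add, map_add, hx, hy]
  | hs c x hx => rw [map_smul, map_smul, map_smul, hx]


/-- The continuous functional calculus `f ↦ f(u)` of a unitary `u`, for `f` on the circle. -/
def circleFC (u : unitary B) : C(Circle, ℂ) →⋆ₐ[ℂ] B :=
  (cfcHom (R := ℂ) (a := (u : B)) (inferInstance : IsStarNormal (u : B))).comp
    (ContinuousMap.compStarAlgHom' ℂ ℂ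
      ⟨fun z => (⟨z.1, by
        simpa [Submonoid.unitSphere] using Unitary.spectrum_subset_circle u z.2⟩ : Circle),
        by fun_prop⟩)

/-- The inclusion function `𝕋 → ℂ`. -/
def circleCoe : C(Circle, ℂ) := ⟨fun z => (z : ℂ), by fun_prop⟩

theorem circleFC_coe (u : unitary B) : circleFC u circleCoe = u :=
  cfcHom_id (R := ℂ) (a := (u : B)) (inferInstance : IsStarNormal (u : B))

theorem circleHom_ext {φ ψ : C(Circle, ℂ) →⋆ₐ[ℂ] B} (h : φ circleCoe = ψ circleCoe) :
    φ = ψ := by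
  have : CompactSpace ((Submonoid.unitSphere ℂ : Set ℂ)) :=
    inferInstanceAs (CompactSpace Circle)
  refine ContinuousMap.starAlgHom_ext_map_X (s := (Submonoid.unitSphere ℂ : Set ℂ))
    (continuous_starAlgHom φ) (continuous_starAlgHom ψ) ?_
  have hX : (Polynomial.toContinuousMapOnAlgHom (Submonoid.unitSphere ℂ : Set ℂ) Polynomial.X :
      C((Submonoid.unitSphere ℂ : Set ℂ), ℂ)) = (circleCoe : C(Circle, ℂ)) :=
    ContinuousMap.ext fun z => Polynomial.eval_X (x := (z : ℂ))
  rw [hX]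
  exact h

theorem map_circleFC {C : Type*} [CStarAlgebra C] (φ : B →⋆ₐ[ℂ] C) (u : unitary B)
    (v : unitary C) (h : φ u = v) (g : C(Circle, ℂ)) : φ (circleFC u g) = circleFC v g := by
  have : φ.comp (circleFC u) = circleFC v := circleHom_ext <| by
    rw [StarAlgHom.comp_apply, circleFC_coe, circleFC_coe, h]
  exact DFunLike.congr_fun this g

theorem star_coe_mul_coe (z : Circle) : star (z : ℂ) * (z : ℂ) = 1 := by
  rw [← starRingEnd_apply, ← Circle.coe_inv_eq_conj, ← Circle.coe_mul, inv_mul_cancel,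
    Circle.coe_one]

/-- The unitary `z u` for `z` in the circle. -/
def rotate (z : Circle) (u : unitary B) : unitary B :=
  ⟨(z : ℂ) • (u : B), by
    rw [Unitary.mem_iff, star_smul, smul_mul_smul_comm, smul_mul_smul_comm,
      mul_comm (z : ℂ), star_coe_mul_coe, one_smul, one_smul]
    exact Unitary.mem_iff.1 u.2⟩

theorem coe_rotate (z : Circle) (u : unitary B) : (rotate z u : B) = (z : ℂ) • (u : B) := rfl

theorem circleFC_rotate (z : Circle) (u : unitary B) (g : C(Circle, ℂ)) :
    circleFC (rotate z u) g = circleFC u (g.comp ⟨fun w => z * w, by fun_prop⟩) := by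
  have : circleFC (rotate z u) =
      (circleFC u).comp (ContinuousMap.compStarAlgHom' ℂ ℂ ⟨fun w => z * w, by fun_prop⟩) :=
    circleHom_ext <| by
      rw [circleFC_coe, StarAlgHom.comp_apply, coe_rotate, ← circleFC_coe u, ← map_smul]
      rfl
  rw [this]; rfl

/-- The unitary `f(u)` for continuous `f : 𝕋 → 𝕋`. -/
def circleFCUnitary (u : unitary B) (f : C(Circle, Circle)) : unitary B :=
  ⟨circleFC u (circleCoe.comp f), by
    have h1 : star (circleCoe.comp f) * circleCoe.comp f = 1 := 
      ContinuousMap.ext fun z => star_coe_mul_coe (f z)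
    rw [Unitary.mem_iff, ← map_star, ← map_mul, ← map_mul, h1, mul_comm, h1, map_one]
    exact ⟨rfl, rfl⟩⟩

theorem coe_circleFCUnitary (u : unitary B) (f : C(Circle, Circle)) :
    (circleFCUnitary u f : B) = circleFC u (circleCoe.comp f) := rfl

theorem commute_circleFCUnitary (u : unitary B) (f : C(Circle, Circle)) :
    (u : B) * circleFCUnitary u f = circleFCUnitary u f * u := by
  rw [coe_circleFCUnitary, ← circleFC_coe u, ← map_mul, mul_comm, map_mul, circleFC_coe]

theorem torusRelation_anzai (z : Circle) (f : C(Circle, Circle)) :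
    TorusRelation α (rotate z (U α)) (circleFCUnitary (U α) f * V α) := by
  have h := torusRelation_U_V α
  unfold TorusRelation at h ⊢
  rw [coe_rotate, Submonoid.coe_mul, smul_mul_assoc, ← mul_assoc, commute_circleFCUnitary,
    mul_assoc, h, mul_smul_comm, mul_smul_comm, smul_comm, ← mul_assoc]

variable (α)

/-- The *-homomorphism with `U ↦ z U`, `V ↦ f(U) V`. -/
def anzaiHom (z : Circle) (f : C(Circle, Circle)) : NCTorus α →⋆ₐ[ℂ] NCTorus α :=
  lift (rotate z (U α)) (circleFCUnitary (U α) f * V α) (torusRelation_anzai z f)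

theorem anzaiHom_comp (z w : Circle) (f g : C(Circle, Circle)) :
    (anzaiHom α w g).comp (anzaiHom α z f) =
      anzaiHom α (z * w) (f.comp ⟨fun x => w * x, by fun_prop⟩ * g) := by
  apply hom_ext
  · simp only [StarAlgHom.comp_apply, anzaiHom, lift_U, coe_rotate, map_smul, smul_smul,
      Circle.coe_mul]
  · rw [StarAlgHom.comp_apply, anzaiHom, anzaiHom, anzaiHom, lift_V, lift_V, Submonoid.coe_mul,
      map_mul, lift_V, coe_circleFCUnitary,
      map_circleFC _ _ (rotate w (U α)) (lift_U _ _ _), circleFC_rotate, Submonoid.coe_mul,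
      Submonoid.coe_mul, ← mul_assoc, coe_circleFCUnitary, coe_circleFCUnitary, ← map_mul]
    rfl

theorem anzaiHom_one : anzaiHom α 1 1 = StarAlgHom.id ℂ (NCTorus α) := by
  apply hom_ext
  · simp [anzaiHom, coe_rotate]
  · rw [anzaiHom, lift_V, Submonoid.coe_mul, coe_circleFCUnitary]
    have : circleCoe.comp (1 : C(Circle, Circle)) = 1 := rfl
    rw [this, map_one, one_mul]; rfl

/-- The Anzai skew-product `Φ_{θ,f}`: the *-automorphism of `𝔸_α` with `U ↦ e^{iθ} U` and
`V ↦ f(U) V`, see `anzai_U` and `anzai_V`. -/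
def anzai (θ : ℝ) (f : C(Circle, Circle)) : NCTorus α ≃⋆ₐ[ℂ] NCTorus α :=
  StarAlgEquiv.ofStarAlgHom (anzaiHom α (Circle.exp θ) f)
    (anzaiHom α (Circle.exp (-θ)) (f.comp ⟨fun x => Circle.exp (-θ) * x, by fun_prop⟩)⁻¹)
    (by
      rw [anzaiHom_comp, ← Circle.exp_add, add_neg_cancel, Circle.exp_zero, mul_inv_cancel,
        anzaiHom_one])
    (by
      rw [anzaiHom_comp, ← Circle.exp_add, neg_add_cancel, Circle.exp_zero, ← anzaiHom_one]
      congr 1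
      ext z
      simp [← mul_assoc])

theorem anzai_U (θ : ℝ) (f : C(Circle, Circle)) :
    anzai α θ f (U α) = Complex.exp (θ * Complex.I) • (U α : NCTorus α) :=
  (lift_U _ _ (torusRelation_anzai _ f)).trans (by rw [coe_rotate, Circle.coe_exp])

theorem anzai_V (θ : ℝ) (f : C(Circle, Circle)) :
    anzai α θ f (V α) = circleFC (U α) (circleCoe.comp f) * V α :=
  lift_V _ _ (torusRelation_anzai _ f)

end NCTorus

/-- The Hilbert space `ℓ²(ℤ × ℤ)`. -/
abbrev TorusL2 : Type := lp (fun _ : ℤ × ℤ => ℂ) 2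

namespace NCTorus

variable (α : ℝ)

theorem memℓp_weighted (σ : ℤ × ℤ ≃ ℤ × ℤ) (c : ℤ × ℤ → Circle) (x : TorusL2) :
    Memℓp (fun i => (c i : ℂ) * x (σ i)) 2 := by
  have h := lp.memℓp x
  rw [memℓp_gen_iff (by simp)] at h ⊢
  simpa [Circle.norm_coe, Function.comp_def] using (σ.summable_iff (f := fun i => ‖x i‖ ^ (2 : ENNReal).toReal)).2 h

/-- The weighted permutation operator `(W x)(i) = c(i) x(σ(i))`. -/
def weighted (σ : ℤ × ℤ ≃ ℤ × ℤ) (c : ℤ × ℤ → Circle) : TorusL2 ≃ₗᵢ[ℂ] TorusL2 where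
  toFun x := ⟨fun i => (c i : ℂ) * x (σ i), memℓp_weighted σ c x⟩
  invFun x := ⟨fun i => ((c (σ.symm i))⁻¹ : Circle) * x (σ.symm i),
    memℓp_weighted σ.symm (fun i => (c (σ.symm i))⁻¹) x⟩
  map_add' x y := by ext i; exact mul_add _ _ _
  map_smul' r x := by ext i; exact mul_left_comm _ _ _
  left_inv x := by
    ext i
    simp
  right_inv x := by
    ext i
    simp
  norm_map' x := by
    rw [lp.norm_eq_tsum_rpow (by simp), lp.norm_eq_tsum_rpow (by simp)]
    congr 1
    simpa [Circle.norm_coe] using (σ.tsum_eq (f := fun i => ‖x i‖ ^ (2 : ENNReal).toReal))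

theorem weighted_apply (σ : ℤ × ℤ ≃ ℤ × ℤ) (c : ℤ × ℤ → Circle) (x : TorusL2) (i : ℤ × ℤ) :
    weighted σ c x i = (c i : ℂ) * x (σ i) := rfl

/-- `(U x)(m, n) = x(m - 1, n)`, i.e. `U e_{m,n} = e_{m+1,n}`. -/
def regU : unitary (TorusL2 →L[ℂ] TorusL2) :=
  Unitary.linearIsometryEquiv.symm
    (weighted (Equiv.addRight (-1, 0)) 1)

/-- `(V x)(m, n) = e^{-2πiαm} x(m, n - 1)`, i.e. `V e_{m,n} = e^{-2πiαm} e_{m,n+1}`. -/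
def regV : unitary (TorusL2 →L[ℂ] TorusL2) :=
  Unitary.linearIsometryEquiv.symm
    (weighted (Equiv.addRight (0, -1)) (fun i => Circle.exp (-(2 * Real.pi * α * i.1))))

theorem regU_apply (x : TorusL2) (i : ℤ × ℤ) :
    (regU : TorusL2 →L[ℂ] TorusL2) x i = x (i.1 - 1, i.2) := by
  have : (regU : TorusL2 →L[ℂ] TorusL2) x i = _ := weighted_apply _ _ x i
  rw [this]
  simp [Prod.add_def, sub_eq_add_neg]

theorem regV_apply (x : TorusL2) (i : ℤ × ℤ) :
    (regV α : TorusL2 →L[ℂ] TorusL2) x i =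
      Complex.exp (-(2 * Real.pi * Complex.I * α * i.1)) * x (i.1, i.2 - 1) := by
  have : (regV α : TorusL2 →L[ℂ] TorusL2) x i = _ := weighted_apply _ _ x i
  rw [this]
  simp only [Circle.coe_exp, Equiv.coe_addRight, Prod.add_def, sub_eq_add_neg, add_zero]
  congr 2
  push_cast; ring

theorem torusRelation_reg : TorusRelation α regU (regV α) := by
  refine ContinuousLinearMap.ext fun x => lp.ext <| funext fun i => ?_
  have h1 : ((regU : TorusL2 →L[ℂ] TorusL2) * (regV α : TorusL2 →L[ℂ] TorusL2)) x i = _ :=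
    (regU_apply _ i).trans (regV_apply α x _)
  have h2 : ((regV α : TorusL2 →L[ℂ] TorusL2) * (regU : TorusL2 →L[ℂ] TorusL2)) x i = _ :=
    (regV_apply α _ i).trans (congrArg _ (regU_apply x _))
  refine h1.trans (Eq.trans ?_ (congrArg (Complex.exp (2 * Real.pi * Complex.I * α) * ·) h2).symm)
  rw [← mul_assoc, ← Complex.exp_add]
  congr 2
  push_cast; ring

/-- The regular representation of `𝔸_α` on `ℓ²(ℤ × ℤ)`. -/
def regRep : NCTorus α →⋆ₐ[ℂ] (TorusL2 →L[ℂ] TorusL2) :=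
  lift regU (regV α) (torusRelation_reg α)

/-- The basis vector `e_{0,0}`. -/
def vac : TorusL2 := lp.single 2 (0, 0) (1 : ℂ)

/-- The canonical trace `τ`, the vector state of `e_{0,0}`. It is the unique bounded functional with
`τ(U^m V^n) = δ_{m,0} δ_{n,0}`, see `trace_zpow_mul_zpow`. -/
def trace : NCTorus α →L[ℂ] ℂ :=
  (innerSL ℂ vac).comp ((ContinuousLinearMap.apply ℂ TorusL2 vac).comp
    ⟨(regRep α : NCTorus α →ₗ[ℂ] (TorusL2 →L[ℂ] TorusL2)), continuous_starAlgHom (regRep α)⟩)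

theorem trace_apply (a : NCTorus α) : trace α a = inner ℂ vac (regRep α a vac) := rfl

theorem regU_zpow_apply (m : ℤ) (x : TorusL2) (i : ℤ × ℤ) :
    ((regU ^ m : unitary (TorusL2 →L[ℂ] TorusL2)) : TorusL2 →L[ℂ] TorusL2) x i =
      x (i.1 - m, i.2) := by
  induction m using Int.induction_on generalizing x i with
  | zero => simp
  | succ m ih =>
    rw [zpow_add_one]
    refine (ih _ i).trans ((regU_apply x _).trans ?_)
    simp [sub_sub]
  | pred m ih =>
    rw [zpow_sub_one]
    refine (ih _ i).trans ?_
    have h : (regU : TorusL2 →L[ℂ] TorusL2)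
        (((regU⁻¹ : unitary (TorusL2 →L[ℂ] TorusL2)) : TorusL2 →L[ℂ] TorusL2) x) = x :=
      DFunLike.congr_fun (congrArg Subtype.val (mul_inv_cancel regU)) x
    have h2 := regU_apply (((regU⁻¹ : unitary (TorusL2 →L[ℂ] TorusL2)) : TorusL2 →L[ℂ] TorusL2) x)
      (i.1 - (-m - 1), i.2)
    rw [h] at h2
    rw [h2]
    have e : i.1 - (-(m : ℤ) - 1) - 1 = i.1 - -(m : ℤ) := by ring
    simp only [e]
    rfl

theorem regV_zpow_apply (n : ℤ) (x : TorusL2) (i : ℤ × ℤ) :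
    ((regV α ^ n : unitary (TorusL2 →L[ℂ] TorusL2)) : TorusL2 →L[ℂ] TorusL2) x i =
      Complex.exp (-(2 * Real.pi * Complex.I * α * i.1)) ^ n * x (i.1, i.2 - n) := by
  induction n using Int.induction_on generalizing x i with
  | zero => simp
  | succ n ih =>
    rw [zpow_add_one]
    refine (ih _ i).trans ((congrArg _ (regV_apply α x _)).trans ?_)
    rw [← mul_assoc, ← zpow_add_one₀ (Complex.exp_ne_zero _), sub_sub]
  | pred n ih =>
    rw [zpow_sub_one]
    refine (ih _ i).trans ?_
    have h : (regV α : TorusL2 →L[ℂ] TorusL2)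
        ((((regV α)⁻¹ : unitary (TorusL2 →L[ℂ] TorusL2)) : TorusL2 →L[ℂ] TorusL2) x) = x :=
      DFunLike.congr_fun (congrArg Subtype.val (mul_inv_cancel (regV α))) x
    have h2 := regV_apply α ((((regV α)⁻¹ : unitary (TorusL2 →L[ℂ] TorusL2)) : TorusL2 →L[ℂ] TorusL2) x)
      (i.1, i.2 - (-n - 1))
    rw [h] at h2
    rw [h2, ← mul_assoc, ← zpow_add_one₀ (Complex.exp_ne_zero _)]
    have e : i.2 - (-(n : ℤ) - 1) - 1 = i.2 - -(n : ℤ) := by ring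
    have e2 : -(n : ℤ) - 1 + 1 = -(n : ℤ) := by ring
    simp only [e, e2]
    rfl

/-- The canonical trace satisfies `τ(U^m V^n) = δ_{m,0} δ_{n,0}`. -/
theorem trace_zpow_mul_zpow (m n : ℤ) :
    trace α ((U α ^ m * V α ^ n : unitary (NCTorus α)) : NCTorus α) =
      if m = 0 ∧ n = 0 then 1 else 0 := by
  let R : NCTorus α →⋆* (TorusL2 →L[ℂ] TorusL2) :=
    { toFun := regRep α
      map_one' := map_one _
      map_mul' := map_mul _
      map_star' := map_star _ }
  have hU : Unitary.map R (U α) = regU := Subtype.ext (lift_U _ _ (torusRelation_reg α))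
  have hV : Unitary.map R (V α) = regV α := Subtype.ext (lift_V _ _ (torusRelation_reg α))
  have h : regRep α ((U α ^ m * V α ^ n : unitary (NCTorus α)) : NCTorus α) =
      ((regU ^ m * regV α ^ n : unitary (TorusL2 →L[ℂ] TorusL2)) : TorusL2 →L[ℂ] TorusL2) := by
    rw [← hU, ← hV, ← map_zpow, ← map_zpow, ← map_mul]; rfl
  have h2 : ((regU ^ m * regV α ^ n : unitary (TorusL2 →L[ℂ] TorusL2)) :
      TorusL2 →L[ℂ] TorusL2) vac (0, 0) = _ :=
    (regU_zpow_apply m _ _).trans (regV_zpow_apply α n _ _)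
  have h3 : ∀ x : TorusL2, inner ℂ vac x = x (0, 0) := fun x =>
    (lp.inner_single_left (0, 0) (1 : ℂ) x).trans (by simp)
  rw [trace_apply, h, h3, h2, vac, lp.single_apply, Pi.single_apply]
  by_cases hm : m = 0
  · by_cases hn : n = 0
    · simp [hm, hn]
    · simp [hm, hn]
  · simp [hm]

end NCTorus

section states
variable {A : Type*} [CStarAlgebra A]
open scoped ComplexOrder in
/-- The states of a unital C*-algebra: the positive functionals with value one at the identity. -/
def stateSpace (A : Type*) [CStarAlgebra A] : Set (A →L[ℂ] ℂ) :=
  {φ | φ 1 = 1 ∧ ∀ a, 0 ≤ φ (star a * a)}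

/-- The states invariant under the *-automorphism `Φ`. -/
def invariantStates (Φ : A ≃⋆ₐ[ℂ] A) : Set (A →L[ℂ] ℂ) :=
  {φ | φ ∈ stateSpace A ∧ ∀ a, φ (Φ a) = φ a}

/-- The system `(A, Φ, φ)` is ergodic: `φ` is an extreme point of the convex set of invariant
states. -/
def IsErgodicState (Φ : A ≃⋆ₐ[ℂ] A) (φ : A →L[ℂ] ℂ) : Prop :=
  φ ∈ (invariantStates Φ).extremePoints ℝ

/-- The system `(A, Φ)` is uniquely ergodic: there is exactly one invariant state. -/
def IsUniquelyErgodic (Φ : A ≃⋆ₐ[ℂ] A) : Prop := ∃! φ, φ ∈ invariantStates Φ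

end states

end

/-!
The gauge action `V ↦ z V` of the circle commutes with `Φ_{θ,f}`, so an invariant state `φ` moves
along an orbit of invariant states `φ ∘ γ_z`. The Haar average of this orbit is `τ`: irrationality
of `θ / 2π` forces `φ (U ^ m) = 0` for `m ≠ 0`, and the average kills every `U ^ m V ^ n` with
`n ≠ 0`. Conditioning Haar measure on a set of positive measure with non-null complement writes `τ`
as a proper convex combination of two invariant states, both equal to `τ` by extremality. Hence
`z ↦ φ (γ_z a)` has the same average over every such set, so this continuous function is constant,
and its value `φ a` at `z = 1` is its average `τ a`.
-/

open MeasureTheory ProbabilityTheory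

section NormalForm

variable {G : Type*} [Group G] {ζ u v : G}

theorem mul_zpow_eq_of_mul_eq (hv : Commute ζ v) (h : u * v = ζ * (v * u)) (n : ℤ) :
    u * v ^ n = ζ ^ n * (v ^ n * u) := by
  have hconj : SemiconjBy u v (ζ * v) := h.trans (mul_assoc _ _ _).symm
  rw [(hconj.zpow_right n).eq, hv.mul_zpow, mul_assoc]

theorem zpow_mul_zpow_eq_of_mul_eq (hu : Commute ζ u) (hv : Commute ζ v)
    (h : u * v = ζ * (v * u)) (m n : ℤ) :
    v ^ n * u ^ m = ζ ^ (-(n * m)) * (u ^ m * v ^ n) := by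
  have hflip : v ^ n * u = ζ ^ (-n) * (u * v ^ n) := by
    rw [mul_zpow_eq_of_mul_eq hv h n, ← mul_assoc, ← zpow_add, neg_add_cancel, zpow_zero, one_mul]
  rw [mul_zpow_eq_of_mul_eq (hu.zpow_left (-n)) hflip, ← zpow_mul, neg_mul]

theorem exists_eq_zpow_mul_of_mem_closure_pair (hu : Commute ζ u) (hv : Commute ζ v)
    (h : u * v = ζ * (v * u)) {g : G} (hg : g ∈ Subgroup.closure {u, v}) :
    ∃ k m n : ℤ, g = ζ ^ k * (u ^ m * v ^ n) := by
  have hcomm : ∀ k m n : ℤ, Commute (ζ ^ k) (u ^ m * v ^ n) := fun k m n =>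
    (hu.zpow_zpow k m).mul_right (hv.zpow_zpow k n)
  induction hg using Subgroup.closure_induction with
  | mem x hx =>
    obtain rfl | rfl := hx
    · exact ⟨0, 1, 0, by simp⟩
    · exact ⟨0, 0, 1, by simp⟩
  | one => exact ⟨0, 0, 0, by simp⟩
  | mul x y _ _ hx hy =>
    obtain ⟨k, m, n, rfl⟩ := hx
    obtain ⟨k', m', n', rfl⟩ := hy
    refine ⟨k + k' + -(n * m'), m + m', n + n', ?_⟩
    calc ζ ^ k * (u ^ m * v ^ n) * (ζ ^ k' * (u ^ m' * v ^ n'))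
      _ = ζ ^ k * ζ ^ k' * (u ^ m * (v ^ n * u ^ m') * v ^ n') := by
        rw [mul_assoc, ← mul_assoc (u ^ m * v ^ n), ← (hcomm k' m n).eq]
        simp only [mul_assoc]
      _ = ζ ^ k * ζ ^ k' * ζ ^ (-(n * m')) * (u ^ m * u ^ m' * (v ^ n * v ^ n')) := by
        rw [zpow_mul_zpow_eq_of_mul_eq hu hv h, ← mul_assoc (u ^ m),
          ← (hu.zpow_zpow (-(n * m')) m).eq]
        simp only [mul_assoc]
      _ = ζ ^ (k + k' + -(n * m')) * (u ^ (m + m') * v ^ (n + n')) := by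
        simp only [zpow_add]
  | inv x _ hx =>
    obtain ⟨k, m, n, rfl⟩ := hx
    refine ⟨-(-n * -m) + -k, -m, -n, ?_⟩
    calc (ζ ^ k * (u ^ m * v ^ n))⁻¹
      _ = v ^ (-n) * u ^ (-m) * ζ ^ (-k) := by simp only [mul_inv_rev, zpow_neg]
      _ = ζ ^ (-(-n * -m) + -k) * (u ^ (-m) * v ^ (-n)) := by
        rw [zpow_mul_zpow_eq_of_mul_eq hu hv h, mul_assoc, ← (hcomm _ _ _).eq, ← mul_assoc,
          zpow_add]

end NormalForm

section Unitary

variable {A B : Type*} [Monoid A] [StarMul A] [Monoid B] [StarMul B]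

theorem map_coe_zpow {F : Type*} [FunLike F A B] [MonoidHomClass F A B] [StarHomClass F A B]
    (φ : F) {u : unitary A} {v : unitary B} (h : φ u = v) (n : ℤ) :
    φ ((u ^ n : unitary A) : A) = ((v ^ n : unitary B) : B) := by
  have hv : Unitary.map (StarMonoidHom.ofClass φ) u = v := Subtype.ext h
  rw [← hv, ← map_zpow]
  rfl

/-- A continuous family of unitaries of `B`, as a unitary of `C(X, B)`. -/
def pointwiseUnitary {X : Type*} [TopologicalSpace X] [TopologicalSpace B] [ContinuousMul B]
    [ContinuousStar B] (u : C(X, unitary B)) : unitary C(X, B) :=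
  ⟨⟨fun x => u x, by fun_prop⟩, Unitary.mem_iff.2
    ⟨ContinuousMap.ext fun x => Unitary.coe_star_mul_self (u x),
      ContinuousMap.ext fun x => Unitary.coe_mul_star_self (u x)⟩⟩

end Unitary

section FiberAverage

variable {X A B : Type*} [TopologicalSpace X] [CStarAlgebra A] [CStarAlgebra B]

/-- The homomorphism `δ_x : A → B` at the point `x` of a continuous family of homomorphisms, which
is encoded as a single homomorphism `δ : A → C(X, B)`. -/
def fiberHom (δ : A →⋆ₐ[ℂ] C(X, B)) (x : X) : A →⋆ₐ[ℂ] B where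
  toFun a := δ a x
  map_one' := by rw [map_one, ContinuousMap.one_apply]
  map_mul' a b := by rw [map_mul, ContinuousMap.mul_apply]
  map_zero' := by rw [map_zero, ContinuousMap.zero_apply]
  map_add' a b := by rw [map_add, ContinuousMap.add_apply]
  commutes' c := DFunLike.congr_fun (AlgHomClass.commutes δ c) x
  map_star' a := by rw [map_star, ContinuousMap.star_apply]

variable [CompactSpace X] [MeasurableSpace X] [OpensMeasurableSpace X]

theorem integrable_apply_continuousMap {E : Type*} [NormedAddCommGroup E] [NormedSpace ℂ E]
    (μ : Measure X) [IsFiniteMeasure μ] (φ : E →L[ℂ] ℂ) (f : C(X, E)) :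
    Integrable (fun x => φ (f x)) μ :=
  (φ.continuous.comp f.continuous).integrable_of_hasCompactSupport
    (HasCompactSupport.of_compactSpace _)

/-- The average `a ↦ ∫ x, φ (δ a x) ∂μ` of the functionals `φ ∘ δ_x` over a continuous family
of homomorphisms `δ_x`, see `fiberHom`. -/
noncomputable def fiberAverage (μ : Measure X) [IsFiniteMeasure μ] (δ : A →⋆ₐ[ℂ] C(X, B))
    (φ : B →L[ℂ] ℂ) : A →L[ℂ] ℂ :=
  LinearMap.mkContinuous
    { toFun := fun a => ∫ x, φ (δ a x) ∂μ
      map_add' := fun a b => by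
        simp only [map_add, ContinuousMap.add_apply]
        exact integral_add (integrable_apply_continuousMap μ φ _)
          (integrable_apply_continuousMap μ φ _)
      map_smul' := fun c a => by
        simp only [map_smul, ContinuousMap.smul_apply, RingHom.id_apply]
        exact integral_smul c _ }
    (‖φ‖ * μ.real Set.univ) fun a => by
      rw [mul_right_comm]
      refine norm_integral_le_of_norm_le_const
        (.of_forall fun x => φ.le_of_opNorm_le_of_le le_rfl ?_)
      exact ((δ a).norm_coe_le_norm x).trans (NonUnitalStarAlgHom.norm_apply_le δ a)

variable {μ : Measure X} {δ : A →⋆ₐ[ℂ] C(X, B)} {φ : B →L[ℂ] ℂ}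

theorem fiberAverage_apply [IsFiniteMeasure μ] (a : A) :
    fiberAverage μ δ φ a = ∫ x, φ (δ a x) ∂μ := rfl

theorem fiberAverage_cond_apply [IsFiniteMeasure μ] (s : Set X) (a : A) :
    fiberAverage μ[|s] δ φ a = ⨍ x in s, φ (δ a x) ∂μ := by
  rw [fiberAverage_apply, setAverage_eq', ProbabilityTheory.cond]

theorem real_smul_fiberAverage_cond_add_compl [IsFiniteMeasure μ] {s : Set X}
    (hs : MeasurableSet s) :
    μ.real s • fiberAverage μ[|s] δ φ + μ.real sᶜ • fiberAverage μ[|sᶜ] δ φ =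
      fiberAverage μ δ φ := by
  ext a
  simp only [_root_.add_apply, _root_.smul_apply, fiberAverage_cond_apply]
  rw [measure_smul_setAverage _ (measure_ne_top μ s),
    measure_smul_setAverage _ (measure_ne_top μ sᶜ),
    integral_add_compl hs (integrable_apply_continuousMap μ φ _), fiberAverage_apply]

open scoped ComplexOrder in
theorem fiberAverage_mem_stateSpace [IsProbabilityMeasure μ] (hφ : φ ∈ stateSpace B) :
    fiberAverage μ δ φ ∈ stateSpace A := by
  refine ⟨?_, fun a => integral_nonneg fun x => ?_⟩
  · simp [fiberAverage_apply, hφ.1]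
  · rw [map_mul, map_star]
    exact hφ.2 _

variable {Φ : A ≃⋆ₐ[ℂ] A} {Ψ : B ≃⋆ₐ[ℂ] B}

theorem fiberAverage_mem_invariantStates [IsProbabilityMeasure μ]
    (hδ : ∀ a x, δ (Φ a) x = Ψ (δ a x)) (hφ : φ ∈ invariantStates Ψ) :
    fiberAverage μ δ φ ∈ invariantStates Φ :=
  ⟨fiberAverage_mem_stateSpace hφ.1, fun a => by simp only [fiberAverage_apply, hδ, hφ.2]⟩

theorem fiberAverage_cond_eq_of_isErgodicState [IsProbabilityMeasure μ]
    (hδ : ∀ a x, δ (Φ a) x = Ψ (δ a x)) (hφ : φ ∈ invariantStates Ψ)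
    (herg : IsErgodicState Φ (fiberAverage μ δ φ)) {s : Set X} (hs : MeasurableSet s)
    (hμs : μ s ≠ 0) (hμsc : μ sᶜ ≠ 0) :
    fiberAverage μ[|s] δ φ = fiberAverage μ δ φ ∧
      fiberAverage μ[|sᶜ] δ φ = fiberAverage μ δ φ := by
  have := cond_isProbabilityMeasure hμs
  have := cond_isProbabilityMeasure hμsc
  exact (mem_extremePoints.1 herg).2 _ (fiberAverage_mem_invariantStates hδ hφ) _
    (fiberAverage_mem_invariantStates hδ hφ)
    ⟨μ.real s, μ.real sᶜ, ENNReal.toReal_pos hμs (measure_ne_top μ s),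
      ENNReal.toReal_pos hμsc (measure_ne_top μ sᶜ),
      probReal_add_probReal_compl hs, real_smul_fiberAverage_cond_add_compl hs⟩

theorem apply_fiber_eq_of_isErgodicState [IsProbabilityMeasure μ] [μ.IsOpenPosMeasure]
    (hδ : ∀ a x, δ (Φ a) x = Ψ (δ a x)) (hφ : φ ∈ invariantStates Ψ)
    (herg : IsErgodicState Φ (fiberAverage μ δ φ)) (a : A) (x : X) :
    φ (δ a x) = fiberAverage μ δ φ a := by
  rcases ae_eq_const_or_exists_average_ne_compl (integrable_apply_continuousMap μ φ (δ a)) with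
    hconst | ⟨s, hs, hμs, hμsc, hne⟩
  · rw [average_eq_integral] at hconst
    have hcont : Continuous fun x => φ (δ a x) := φ.continuous.comp (δ a).continuous
    exact congrFun ((hcont.ae_eq_iff_eq μ continuous_const).1 hconst) x
  · obtain ⟨heq, heqc⟩ := fiberAverage_cond_eq_of_isErgodicState hδ hφ herg hs hμs hμsc
    rw [← fiberAverage_cond_apply, ← fiberAverage_cond_apply, heq, heqc] at hne
    exact absurd rfl hne

end FiberAverage

theorem circleExp_zpow_ne_one {θ : ℝ} (hθ : Irrational (θ / (2 * Real.pi))) {m : ℤ} (hm : m ≠ 0) :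
    Circle.exp θ ^ m ≠ 1 := by
  rw [← Circle.exp_intCast_mul, Ne, Circle.exp_eq_one]
  rintro ⟨k, hk⟩
  refine (hθ.intCast_mul hm).ne_int k ?_
  rw [← mul_div_assoc, hk, mul_div_cancel_right₀ _ Real.two_pi_pos.ne']

theorem integral_fourier {T : ℝ} [Fact (0 < T)] (n : ℤ) :
    ∫ t : AddCircle T, fourier n t ∂AddCircle.haarAddCircle = if n = 0 then 1 else 0 := by
  have h := congrFun (fourierCoeff_fourier (T := T) n) 0
  simpa only [fourierCoeff, neg_zero, fourier_zero, one_smul, Pi.single_apply, eq_comm] using h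

namespace NCTorus

section Rotate

variable {B : Type*} [CStarAlgebra B]

theorem rotate_zpow (z : Circle) (u : unitary B) (n : ℤ) :
    rotate z u ^ n = rotate (z ^ n) (u ^ n) :=
  let rotateHom : Circle × unitary B →* unitary B :=
    { toFun := fun p => rotate p.1 p.2
      map_one' := Subtype.ext (one_smul ℂ (1 : B))
      map_mul' := fun _ _ => Subtype.ext (smul_mul_smul_comm _ _ _ _).symm }
  (map_zpow rotateHom (z, u) n).symm

theorem coe_rotate_zpow (z : Circle) (u : unitary B) (n : ℤ) :
    ((rotate z u ^ n : unitary B) : B) = ((z ^ n : Circle) : ℂ) • ((u ^ n : unitary B) : B) := by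
  rw [rotate_zpow, coe_rotate]

theorem continuous_rotate (u : unitary B) : Continuous fun z => rotate z u :=
  (continuous_id.smul continuous_const).subtype_mk _

end Rotate

variable (α : ℝ)

/-- The monomial `U ^ m V ^ n` in the generators; as `U` and `V` are unitaries, the exponents
range over all integers. -/
noncomputable def monomial (m n : ℤ) : NCTorus α :=
  ((U α ^ m * V α ^ n : unitary (NCTorus α)) : NCTorus α)

theorem word_mem_closure (g : FreeGroup (Fin 2)) : word α g ∈ Subgroup.closure {U α, V α} := by
  have hlift : word α = FreeGroup.lift ![U α, V α] :=
    FreeGroup.ext_hom _ _ fun i => by fin_cases i <;> simp [U, V]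
  have hrange : Set.range ![U α, V α] = {U α, V α} :=
    Matrix.range_cons_cons_empty _ _ _
  rw [← hrange, ← FreeGroup.range_lift_eq_closure, hlift]
  exact ⟨g, rfl⟩

theorem U_mul_V : U α * V α = rotate (Circle.exp (2 * Real.pi * α)) 1 * (V α * U α) := by
  refine Subtype.ext ((torusRelation_U_V α).trans ?_)
  simp only [Submonoid.coe_mul, coe_rotate, Circle.coe_exp, OneMemClass.coe_one, smul_mul_assoc,
    one_mul]
  congr 2
  push_cast
  ring

theorem exists_ofPre_word_eq_smul_monomial (g : FreeGroup (Fin 2)) :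
    ∃ (c : ℂ) (m n : ℤ), ofPre α (Pre.word α g) = c • monomial α m n := by
  have hscalar : ∀ (z : Circle) (x : unitary (NCTorus α)), Commute (rotate z 1) x := fun z x =>
    Subtype.ext (by simp [coe_rotate])
  obtain ⟨k, m, n, h⟩ := exists_eq_zpow_mul_of_mem_closure_pair (hscalar _ _) (hscalar _ _)
    (U_mul_V α) (word_mem_closure α g)
  refine ⟨(Circle.exp (2 * Real.pi * α) ^ k : Circle), m, n, (congrArg Subtype.val h).trans ?_⟩
  rw [Submonoid.coe_mul, coe_rotate_zpow, one_zpow, OneMemClass.coe_one, smul_one_mul, monomial]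

theorem dense_span_monomial :
    Dense (Submodule.span ℂ (Set.range fun p : ℤ × ℤ => monomial α p.1 p.2) : Set (NCTorus α)) := by
  refine (denseRange_ofPre α).mono ?_
  rintro _ ⟨x, rfl⟩
  induction x using Pre.induction α with
  | hw g =>
    obtain ⟨c, m, n, h⟩ := exists_ofPre_word_eq_smul_monomial α g
    rw [h]
    exact Submodule.smul_mem _ c (Submodule.subset_span ⟨(m, n), rfl⟩)
  | ha x y hx hy => exact map_add (ofPre α) x y ▸ Submodule.add_mem _ hx hy
  | hs c x hx => exact map_smul (ofPre α) c x ▸ Submodule.smul_mem _ c hx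

variable {α} in
theorem functional_ext {φ ψ : NCTorus α →L[ℂ] ℂ}
    (h : ∀ m n : ℤ, φ (monomial α m n) = ψ (monomial α m n)) : φ = ψ :=
  ContinuousLinearMap.ext_on (dense_span_monomial α) (Set.forall_mem_range.2 fun p => h p.1 p.2)

/-- The gauge action `V ↦ z V` of the circle on `𝔸_α`. It is encoded as one homomorphism into the
continuous functions on `ℝ / ℤ`, whose value at `t` is the action of `z = e^{2πit}`; the universal
property of `𝔸_α` then provides the continuity of the action. -/
noncomputable def gauge : NCTorus α →⋆ₐ[ℂ] C(UnitAddCircle, NCTorus α) :=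
  lift (pointwiseUnitary (.const _ (U α)))
    (pointwiseUnitary ⟨_, (continuous_rotate (V α)).comp AddCircle.continuous_toCircle⟩)
    (ContinuousMap.ext fun t => by
      change (U α : NCTorus α) * ((t.toCircle : ℂ) • (V α : NCTorus α)) =
        Complex.exp (2 * Real.pi * Complex.I * α) •
          (((t.toCircle : ℂ) • (V α : NCTorus α)) * (U α : NCTorus α))
      rw [mul_smul_comm, torusRelation_U_V α, smul_mul_assoc, smul_comm])

theorem gauge_U (t : UnitAddCircle) : gauge α (U α) t = U α :=
  DFunLike.congr_fun (lift_U _ _ _) t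

theorem gauge_V (t : UnitAddCircle) : gauge α (V α) t = rotate t.toCircle (V α) :=
  DFunLike.congr_fun (lift_V _ _ _) t

theorem gauge_monomial (t : UnitAddCircle) (m n : ℤ) :
    gauge α (monomial α m n) t = fourier n t • monomial α m n := by
  change fiberHom (gauge α) t (monomial α m n) = _
  rw [monomial, Submonoid.coe_mul, map_mul, map_coe_zpow (fiberHom (gauge α) t) (gauge_U α t),
    map_coe_zpow (fiberHom (gauge α) t) (gauge_V α t), coe_rotate_zpow, mul_smul_comm,
    fourier_apply, AddCircle.toCircle_zsmul]

theorem gauge_apply_zero (a : NCTorus α) : gauge α a 0 = a := by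
  have h : fiberHom (gauge α) 0 = .id ℂ (NCTorus α) := hom_ext (gauge_U α 0) <| by
    refine (gauge_V α 0).trans ?_
    rw [coe_rotate, AddCircle.toCircle_zero, Circle.coe_one, one_smul]
    rfl
  exact DFunLike.congr_fun h a

theorem gauge_anzai (θ : ℝ) (f : C(Circle, Circle)) (a : NCTorus α) (t : UnitAddCircle) :
    gauge α (anzai α θ f a) t = anzai α θ f (gauge α a t) := by
  have hU : fiberHom (gauge α) t (U α) = U α := gauge_U α t
  have hV : fiberHom (gauge α) t (V α) = (t.toCircle : ℂ) • (V α : NCTorus α) := gauge_V α t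
  have h : (fiberHom (gauge α) t).comp (anzai α θ f : NCTorus α →⋆ₐ[ℂ] NCTorus α) =
      (anzai α θ f : NCTorus α →⋆ₐ[ℂ] NCTorus α).comp (fiberHom (gauge α) t) := by
    apply hom_ext
    · change fiberHom (gauge α) t (anzai α θ f (U α)) = anzai α θ f (fiberHom (gauge α) t (U α))
      rw [hU, anzai_U, map_smul, hU]
    · change fiberHom (gauge α) t (anzai α θ f (V α)) = anzai α θ f (fiberHom (gauge α) t (V α))
      rw [hV, anzai_V, map_smul, anzai_V, map_mul, map_circleFC _ _ (U α) hU, hV, mul_smul_comm]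
  exact DFunLike.congr_fun h a

variable {α} {θ : ℝ} {f : C(Circle, Circle)} {φ : NCTorus α →L[ℂ] ℂ}

theorem apply_U_zpow_eq_zero (hθ : Irrational (θ / (2 * Real.pi)))
    (hφ : φ ∈ invariantStates (anzai α θ f)) {m : ℤ} (hm : m ≠ 0) :
    φ ((U α ^ m : unitary (NCTorus α)) : NCTorus α) = 0 := by
  have hU : anzai α θ f (U α) = rotate (Circle.exp θ) (U α) := by
    rw [anzai_U, coe_rotate, Circle.coe_exp]
  have heigen : φ ((U α ^ m : unitary (NCTorus α)) : NCTorus α) =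
      ((Circle.exp θ ^ m : Circle) : ℂ) * φ ((U α ^ m : unitary (NCTorus α)) : NCTorus α) := by
    rw [← smul_eq_mul, ← map_smul, ← coe_rotate_zpow, ← map_coe_zpow (anzai α θ f) hU, hφ.2]
  exact (mul_left_eq_self₀.1 heigen.symm).resolve_left
    (Circle.coe_eq_one.not.2 (circleExp_zpow_ne_one hθ hm))

theorem fiberAverage_gauge_monomial (φ : NCTorus α →L[ℂ] ℂ) (m n : ℤ) :
    fiberAverage AddCircle.haarAddCircle (gauge α) φ (monomial α m n) =
      if n = 0 then φ (monomial α m n) else 0 := by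
  simp only [fiberAverage_apply, gauge_monomial, map_smul, smul_eq_mul]
  rw [integral_mul_const, integral_fourier, ite_mul, one_mul, zero_mul]

theorem fiberAverage_gauge_eq_trace (hθ : Irrational (θ / (2 * Real.pi)))
    (hφ : φ ∈ invariantStates (anzai α θ f)) :
    fiberAverage AddCircle.haarAddCircle (gauge α) φ = trace α := by
  refine functional_ext fun m n => ?_
  rw [fiberAverage_gauge_monomial, monomial, trace_zpow_mul_zpow]
  rcases eq_or_ne n 0 with rfl | hn
  · rcases eq_or_ne m 0 with rfl | hm
    · simpa using hφ.1.1
    · simpa [hm] using apply_U_zpow_eq_zero hθ hφ hm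
  · simp [hn]

theorem eq_trace_of_isErgodicState_trace (hθ : Irrational (θ / (2 * Real.pi)))
    (herg : IsErgodicState (anzai α θ f) (trace α)) (hφ : φ ∈ invariantStates (anzai α θ f)) :
    φ = trace α := by
  have havg := fiberAverage_gauge_eq_trace hθ hφ
  rw [← havg] at herg
  ext a
  calc φ a = φ (gauge α a 0) := by rw [gauge_apply_zero]
    _ = fiberAverage AddCircle.haarAddCircle (gauge α) φ a :=
      apply_fiber_eq_of_isErgodicState (gauge_anzai α θ f) hφ herg a 0
    _ = trace α a := by rw [havg]

end NCTorus

theorem mainTheorem2 (α θ : ℝ) (hθ : Irrational (θ / (2 * Real.pi))) (f : C(Circle, Circle))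
    (h : IsErgodicState (NCTorus.anzai α θ f) (NCTorus.trace α)) :
    IsUniquelyErgodic (NCTorus.anzai α θ f) ∧
      invariantStates (NCTorus.anzai α θ f) = {NCTorus.trace α} := by
  have hτ : NCTorus.trace α ∈ invariantStates (NCTorus.anzai α θ f) := h.1
  have huniq : ∀ φ ∈ invariantStates (NCTorus.anzai α θ f), φ = NCTorus.trace α := fun _ hφ =>
    NCTorus.eq_trace_of_isErgodicState_trace hθ h hφ
  exact ⟨⟨_, hτ, huniq⟩, Set.eq_singleton_iff_unique_mem.2 ⟨hτ, huniq⟩⟩
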